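/- Let $X_1, X_2, \dots$ be independent, identically distributed real random variables whose common distribution is continuous (has no atoms). For a permutation $\sigma\in\mathcal S_k$, written in one-line notation $\sigma_1\cdots\sigma_k$, a consecutive occurrence of $\sigma$ in the sequence is a block $X_i, X_{i+1},\dots,X_{i+k-1}$ of $k$ consecutive, pairwise distinct entries that are in the same relative order as $\sigma_1,\dots,\sigma_k$. Let $T_\sigma\in\mathbb N\cup\{\infty\}$ be the smallest $n$ such that $X_1,\dots,X_n$ contains a consecutive occurrence of $\sigma$ (with $T_\sigma=\infty$ if there is no such $n$), and let $\Pr(\sigma\prec\tau)=\Pr(T_\sigma<T_\tau)$ be the probability that $\sigma$ appears before $\tau$. Then the patterns $2134$ and $3241$ are a tied pair, that is, $$\Pr(2134\prec 3241)=\Pr(3241\prec 2134)=\tfrac12 .$$ -/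

import Mathlib

open MeasureTheory ProbabilityTheory

namespace PermPenney

/-- The real sequence `x` has a consecutive occurrence of the pattern `σ` starting at position `i`:
the entries `x i, x (i+1), …, x (i+k-1)` are pairwise distinct and in the same relative order as
`σ 0, σ 1, …, σ (k-1)`. -/
def OccursAt {k : ℕ} (σ : Equiv.Perm (Fin k)) (x : ℕ → ℝ) (i : ℕ) : Prop :=
  ∀ a b : Fin k, x (i + a) < x (i + b) ↔ σ a < σ b

/-- The first `n` entries `x 0, …, x (n-1)` of `x` contain a consecutive occurrence of `σ`. -/
def PrefixContains {k : ℕ} (σ : Equiv.Perm (Fin k)) (x : ℕ → ℝ) (n : ℕ) : Prop :=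
  ∃ i : ℕ, i + k ≤ n ∧ OccursAt σ x i

/-- `T_σ`, the number of draws until `σ` is seen for the first time: the smallest `n` such that
the first `n` entries of `x` contain a consecutive occurrence of `σ`, and `⊤` if there is none. -/
noncomputable def firstTime {k : ℕ} (σ : Equiv.Perm (Fin k)) (x : ℕ → ℝ) : ℕ∞ :=
  ⨅ (n : ℕ) (_ : PrefixContains σ x n), (n : ℕ∞)

/-- The event `σ ≺ τ`: the pattern `σ` appears in the random sequence `X`, and it appears
before `τ` does. -/
def precEvent {Ω : Type*} (X : ℕ → Ω → ℝ) {k l : ℕ}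
    (σ : Equiv.Perm (Fin k)) (τ : Equiv.Perm (Fin l)) : Set Ω :=
  {ω | firstTime σ (fun n => X n ω) < firstTime τ (fun n => X n ω)}

/-- `X 0, X 1, …` is a sequence of independent, identically distributed real random variables on
the probability space `(Ω, μ)` whose common distribution is continuous (has no atoms). -/
structure IsIIDContinuous {Ω : Type*} [MeasurableSpace Ω] (μ : Measure Ω) (X : ℕ → Ω → ℝ) :
    Prop where
  measurable : ∀ n, Measurable (X n)
  indep : iIndepFun X μ
  identDistrib : ∀ n, IdentDistrib (X n) (X 0) μ μ
  noAtoms : ∀ (n : ℕ) (c : ℝ), μ {ω | X n ω = c} = 0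

/-- `σ` and `τ` are tied for the random sequence `X`: each of them has probability `1/2`
of appearing before the other. -/
def IsTied {Ω : Type*} [MeasurableSpace Ω] (μ : Measure Ω) (X : ℕ → Ω → ℝ) {k l : ℕ}
    (σ : Equiv.Perm (Fin k)) (τ : Equiv.Perm (Fin l)) : Prop :=
  μ (precEvent X σ τ) = 1 / 2 ∧ μ (precEvent X τ σ) = 1 / 2

/-- The pattern with one-line notation `2134` (positions and values in `Fin 4` start at `0`). -/
def pat2134 : Equiv.Perm (Fin 4) where
  toFun := ![1, 0, 2, 3]
  invFun := ![1, 0, 2, 3]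
  left_inv := by decide
  right_inv := by decide

/-- The pattern with one-line notation `3241` (positions and values in `Fin 4` start at `0`). -/
def pat3241 : Equiv.Perm (Fin 4) where
  toFun := ![2, 1, 3, 0]
  invFun := ![3, 1, 0, 2]
  left_inv := by decide
  right_inv := by decide

theorem pat2134_oneLine : (fun i => (pat2134 i : ℕ) + 1) = ![2, 1, 3, 4] := by decide

theorem pat3241_oneLine : (fun i => (pat3241 i : ℕ) + 1) = ![3, 2, 4, 1] := by decide

end PermPenney

namespace PermPenney

/-! Both patterns open with a block of type `213`, and with minimum `a` and maximum `c` of that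
block, `2134` is completed by a next value above `c` and `3241` by one below `a`. Neither reversal,
complementation nor their composition exchanges the patterns, so no pathwise symmetry is available.
The symmetry appears only in expectation, for uniform entries, under `u ↦ 1 - u`.

Cut the game off after `n` windows and score it `1`, `-1` or `0` (`winner`). Prepending an entry `w`
alters the score only if `w` starts a `213` block, and then by a correction (`gain`) that depends on
`a`, `c` and the later entries, not on `w` (`winner_succ_prepend`, `gain_succ`). Integration gives a
closed recursion for the expected score given the first entry and for the expected correction. By
induction (`value_antisymm`) the former is odd under `w ↦ 1 - w` and the latter under `(a, c) ↦ (1 -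
c, 1 - a)`. Hence the mean score is `0` for every `n`, and `n → ∞` makes the two probabilities
equal.

They sum to `1` because `2134` occurs almost surely (`ae_exists_occursAt`). A general continuous law
reduces to the uniform one by applying its distribution function (`IsIIDContinuous.exists_uniform`).
-/

/-! ### Sequences and the product measure -/

/-- Put a value in front of a sequence. -/
def prepend (w : ℝ) (x : ℕ → ℝ) : ℕ → ℝ
  | 0 => w
  | n + 1 => x n

/-- Drop the first entry of a sequence. -/
def tail (x : ℕ → ℝ) : ℕ → ℝ := fun n => x (n + 1)

@[simp] lemma prepend_zero (w : ℝ) (x : ℕ → ℝ) : prepend w x 0 = w := rfl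
@[simp] lemma prepend_one (w : ℝ) (x : ℕ → ℝ) : prepend w x 1 = x 0 := rfl
@[simp] lemma prepend_two (w : ℝ) (x : ℕ → ℝ) : prepend w x 2 = x 1 := rfl
@[simp] lemma prepend_three (w : ℝ) (x : ℕ → ℝ) : prepend w x 3 = x 2 := rfl
@[simp] lemma tail_apply (x : ℕ → ℝ) (n : ℕ) : tail x n = x (n + 1) := rfl
@[simp] lemma tail_prepend (w : ℝ) (x : ℕ → ℝ) : tail (prepend w x) = x := rfl

lemma measurable_prepend : Measurable fun p : ℝ × (ℕ → ℝ) => prepend p.1 p.2 := by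
  refine measurable_pi_iff.2 fun n => ?_
  cases n with
  | zero => exact measurable_fst
  | succ n => exact (measurable_pi_apply n).comp measurable_snd

@[fun_prop] lemma Measurable.prepend {α : Type*} [MeasurableSpace α] {f : α → ℝ} {g : α → ℕ → ℝ}
    (hf : Measurable f) (hg : Measurable g) : Measurable fun a => prepend (f a) (g a) :=
  measurable_prepend.comp (hf.prodMk hg)

@[fun_prop] lemma measurable_tail : Measurable tail :=
  measurable_pi_iff.2 fun n => measurable_pi_apply (n + 1)

/-- The law of an i.i.d. sequence with one-dimensional law `ρ`. -/
noncomputable abbrev iidLaw (ρ : Measure ℝ) : Measure (ℕ → ℝ) := Measure.infinitePi fun _ => ρ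

lemma map_prepend (ρ : Measure ℝ) [IsProbabilityMeasure ρ] :
    (ρ.prod (iidLaw ρ)).map (fun p => prepend p.1 p.2) = iidLaw ρ := by
  refine Measure.eq_infinitePi _ fun s t ht => ?_
  -- Enlarging the index set to a nonempty initial segment lets coordinate `0` split off as a
  -- separate factor.
  obtain ⟨n, hn⟩ : ∃ n, s ⊆ Finset.range (n + 1) :=
    ⟨s.sup id, fun i hi => Finset.mem_range.2 (Nat.lt_succ_of_le (Finset.le_sup (f := id) hi))⟩
  classical
  set t' : ℕ → Set ℝ := fun i => if i ∈ s then t i else Set.univ with ht'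
  have hm : ∀ i, MeasurableSet (t' i) := fun i => by
    simp only [ht']; split_ifs; exacts [ht i, .univ]
  have h1 : (s : Set ℕ).pi t = (Finset.range (n + 1) : Set ℕ).pi t' := by
    ext x
    simp only [Set.mem_pi, Finset.mem_coe, ht']
    constructor
    · intro h i _
      split_ifs with hi
      exacts [h i hi, trivial]
    · intro h i hi
      simpa [hi] using h i (hn hi)
  have h2 : ∏ i ∈ s, ρ (t i) = ∏ i ∈ Finset.range (n + 1), ρ (t' i) := by
    rw [← Finset.prod_subset hn (fun i _ hi => by simp [ht', hi])]
    exact Finset.prod_congr rfl fun i hi => by simp [ht', hi]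
  have h3 : (fun p : ℝ × (ℕ → ℝ) => prepend p.1 p.2) ⁻¹' (Finset.range (n + 1) : Set ℕ).pi t' =
      t' 0 ×ˢ (Finset.range n : Set ℕ).pi fun i => t' (i + 1) := by
    ext ⟨w, x⟩
    simp only [Set.mem_preimage, Set.mem_pi, Finset.mem_coe, Finset.mem_range, Set.mem_prod]
    constructor
    · intro h
      exact ⟨h 0 n.succ_pos, fun i hi => h (i + 1) (by omega)⟩
    · rintro ⟨h0, h⟩ (_ | i) hi
      exacts [h0, h i (by omega)]
  rw [h1, h2, Measure.map_apply measurable_prepend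
    (MeasurableSet.pi (Finset.countable_toSet _) fun i _ => hm i), h3, Measure.prod_prod,
    Measure.infinitePi_pi _ fun i _ => hm _, Finset.prod_range_succ', mul_comm]

lemma integral_iidLaw {ρ : Measure ℝ} [IsProbabilityMeasure ρ] {f : (ℕ → ℝ) → ℝ}
    (hf : Measurable f) {C : ℝ} (hC : ∀ x, |f x| ≤ C) :
    ∫ x, f x ∂iidLaw ρ = ∫ w, ∫ x, f (prepend w x) ∂iidLaw ρ ∂ρ := by
  conv_lhs => rw [← map_prepend ρ]
  rw [integral_map measurable_prepend.aemeasurable hf.aestronglyMeasurable, integral_prod]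
  exact Integrable.of_bound (hf.comp measurable_prepend).aestronglyMeasurable C
    (ae_of_all _ fun _ => hC _)

lemma iidLaw_inter_tail (ρ : Measure ℝ) [IsProbabilityMeasure ρ] {I : Set ℝ}
    (hI : MeasurableSet I) {S : Set (ℕ → ℝ)} (hS : MeasurableSet S) :
    iidLaw ρ ({x | x 0 ∈ I} ∩ tail ⁻¹' S) = ρ I * iidLaw ρ S := by
  have h : MeasurableSet ({x : ℕ → ℝ | x 0 ∈ I} ∩ tail ⁻¹' S) :=
    (hI.preimage (measurable_pi_apply 0)).inter (hS.preimage measurable_tail)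
  conv_lhs => rw [← map_prepend ρ]
  rw [Measure.map_apply measurable_prepend h, ← Measure.prod_prod]
  rfl

lemma iidLaw_tail (ρ : Measure ℝ) [IsProbabilityMeasure ρ] {S : Set (ℕ → ℝ)}
    (hS : MeasurableSet S) : iidLaw ρ (tail ⁻¹' S) = iidLaw ρ S := by
  simpa using iidLaw_inter_tail ρ MeasurableSet.univ hS

/-! ### The winner among finitely many windows -/

/-- Among the windows starting before `n`, find the first one showing `2134` or `3241`: the value
is `1` if it shows `2134`, `-1` if it shows `3241`, and `0` if there is no such window. -/
noncomputable def winner : ℕ → (ℕ → ℝ) → ℝ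
  | 0, _ => 0
  | n + 1, x =>
    if x 1 < x 0 ∧ x 0 < x 2 ∧ x 2 < x 3 then 1
    else if x 3 < x 1 ∧ x 1 < x 0 ∧ x 0 < x 2 then -1
    else winner n (tail x)

/-- The correction to `winner` due to an initial pattern `213` with minimum `a` and maximum `c`,
followed by the sequence `x`. -/
noncomputable def gain (n : ℕ) (a c : ℝ) (x : ℕ → ℝ) : ℝ :=
  (if c < x 0 then 1 - winner n (prepend c x) else 0) +
    (if x 0 < a then -1 - winner n (prepend c x) else 0)

@[fun_prop] lemma measurable_winner (n : ℕ) : Measurable (winner n) := by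
  induction n with
  | zero => exact measurable_const
  | succ n ih =>
    change Measurable fun x => winner (n + 1) x
    simp only [winner]
    refine Measurable.ite ?_ measurable_const (Measurable.ite ?_ measurable_const
      (ih.comp measurable_tail)) <;>
    measurability

lemma abs_winner_le (n : ℕ) (x : ℕ → ℝ) : |winner n x| ≤ 1 := by
  induction n generalizing x with
  | zero => simp [winner]
  | succ n ih =>
    unfold winner
    split_ifs
    exacts [by simp, by simp, ih _]

lemma measurable_gain (n : ℕ) :
    Measurable fun p : (ℝ × ℝ) × (ℕ → ℝ) => gain n p.1.1 p.1.2 p.2 := by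
  have h : Measurable fun p : (ℝ × ℝ) × (ℕ → ℝ) => winner n (prepend p.1.2 p.2) := by fun_prop
  unfold gain
  refine Measurable.add (Measurable.ite ?_ (measurable_const.sub h) measurable_const)
    (Measurable.ite ?_ (measurable_const.sub h) measurable_const)
  · exact measurableSet_lt (by fun_prop) (by fun_prop)
  · exact measurableSet_lt (by fun_prop) (by fun_prop)

lemma Measurable.gain {α : Type*} [MeasurableSpace α] (n : ℕ) {a c : α → ℝ} {x : α → ℕ → ℝ}
    (ha : Measurable a) (hc : Measurable c) (hx : Measurable x) :
    Measurable fun t => gain n (a t) (c t) (x t) :=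
  (measurable_gain n).comp ((ha.prodMk hc).prodMk hx)

lemma abs_gain_le (n : ℕ) (a c : ℝ) (x : ℕ → ℝ) : |gain n a c x| ≤ 4 := by
  have h := abs_le.1 (abs_winner_le n (prepend c x))
  unfold gain
  rw [abs_le]
  split_ifs <;> constructor <;> linarith

/-- Both patterns begin with a descent. At `n = 0` the truncated `n - 1` is harmless, since both
sides are `0`. -/
lemma winner_of_ascent (n : ℕ) {x : ℕ → ℝ} (hx : x 0 < x 1) :
    winner n x = winner (n - 1) (tail x) := by
  cases n with
  | zero => rfl
  | succ n => simp [winner, hx.not_gt]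

lemma prepend_tail_tail (x : ℕ → ℝ) : prepend (x 1) (tail (tail x)) = tail x := by
  funext n; cases n <;> rfl

/-- A pattern in the new first window forces `w, x 0, x 1` to be of type `213`. Then `x 0 < x 1`, so
without that window the score is already that of `tail x`, which starts at the maximum `x 1`; this
is why `gain` compares with `prepend c x` at level `n - 1`. -/
lemma winner_succ_prepend (n : ℕ) (w : ℝ) (x : ℕ → ℝ) :
    winner (n + 1) (prepend w x) = winner n x +
      if x 0 < w ∧ w < x 1 then gain (n - 1) (x 0) (x 1) (tail (tail x)) else 0 := by
  by_cases h : x 0 < w ∧ w < x 1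
  · rw [if_pos h, winner_of_ascent n (h.1.trans h.2)]
    simp only [winner, gain, prepend_zero, prepend_one, prepend_two, prepend_three, tail_prepend,
      prepend_tail_tail, h, tail_apply, zero_add, Nat.reduceAdd, true_and, and_true,
      winner_of_ascent n (h.1.trans h.2)]
    have := h.1.trans h.2
    split_ifs <;> linarith
  · rw [if_neg h, add_zero, winner, if_neg (fun h' => h ⟨h'.1, h'.2.1⟩),
      if_neg (fun h' => h h'.2), tail_prepend]

lemma gain_zero (a c : ℝ) (x : ℕ → ℝ) :
    gain 0 a c x = (if c < x 0 then 1 else 0) - if x 0 < a then 1 else 0 := by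
  simp only [gain, winner]
  split_ifs <;> norm_num

/-- Here `c` is itself a prepended entry, so it may start a `213` block of its own. This needs `x 0
< c < x 1`, which excludes the branch `c < x 0` and, in the branch `x 0 < a`, leaves only `c < x 1`.
-/
lemma gain_succ (n : ℕ) {a c : ℝ} (hac : a < c) (x : ℕ → ℝ) :
    gain (n + 1) a c x = ((if c < x 0 then 1 else 0) - if x 0 < a then 1 else 0) -
      (if c < x 0 ∨ x 0 < a then winner n x else 0) -
      if x 0 < a ∧ c < x 1 then gain (n - 1) (x 0) (x 1) (tail (tail x)) else 0 := by
  rw [gain, winner_succ_prepend]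
  rcases lt_or_ge c (x 0) with h | h
  · have h1 : ¬ x 0 < a := by linarith
    have h2 : ¬ x 0 < c := by linarith
    simp [h, h1, h2]
  · by_cases h1 : x 0 < a
    · have h2 : x 0 < c := by linarith
      simp only [h.not_gt, h1, h2, if_true, if_false, true_and, or_true]
      ring
    · simp [h.not_gt, h1]

/-! ### Expected values -/

section Expectation

variable (ρ : Measure ℝ)

/-- The expectation of `winner n` for an i.i.d. sequence with first entry `w`. -/
noncomputable def freshValue (n : ℕ) (w : ℝ) : ℝ := ∫ x, winner n (prepend w x) ∂iidLaw ρ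

/-- The expectation of `gain n a c`. -/
noncomputable def gainValue (n : ℕ) (a c : ℝ) : ℝ := ∫ x, gain n a c x ∂iidLaw ρ

/-- The difference between the probabilities of exceeding `c` and of falling below `a`. -/
noncomputable def bias (a c : ℝ) : ℝ :=
  ∫ u, ((if c < u then 1 else 0) - if u < a then 1 else 0) ∂ρ

lemma integral_reflect {ρ : Measure ℝ} (hρ : MeasurePreserving (fun u : ℝ => 1 - u) ρ ρ)
    (f : ℝ → ℝ) : ∫ u, f (1 - u) ∂ρ = ∫ u, f u ∂ρ :=
  hρ.integral_comp (MeasurableEquiv.subLeft (1 : ℝ)).measurableEmbedding f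

lemma bias_reflect {ρ : Measure ℝ} (hρ : MeasurePreserving (fun u : ℝ => 1 - u) ρ ρ)
    (a c : ℝ) :
    bias ρ (1 - c) (1 - a) = -bias ρ a c := by
  unfold bias
  rw [← integral_neg, ← integral_reflect hρ]
  refine integral_congr_ae (ae_of_all _ fun u => ?_)
  simp only [sub_lt_sub_iff_left]
  ring

lemma integral_eq_zero_of_antisymm {ρ : Measure ℝ}
    (hρ : MeasurePreserving (fun u : ℝ => 1 - u) ρ ρ) {f : ℝ → ℝ} (hf : ∀ u, f (1 - u) = -f u) : ∫ u, f u ∂ρ = 0 := by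
  have h := integral_reflect hρ f
  simp_rw [hf, integral_neg] at h
  linarith

variable [IsProbabilityMeasure ρ]

lemma measurable_gainValue (n : ℕ) : Measurable fun p : ℝ × ℝ => gainValue ρ n p.1 p.2 :=
  (measurable_gain n).stronglyMeasurable.integral_prod_right'.measurable

lemma abs_gainValue_le (n : ℕ) (a c : ℝ) : |gainValue ρ n a c| ≤ 4 := by
  simpa [gainValue] using norm_integral_le_of_norm_le_const (μ := iidLaw ρ)
    (f := gain n a c) (C := 4) (ae_of_all _ fun x => abs_gain_le n a c x)

lemma integral_winner (n : ℕ) : ∫ x, winner n x ∂iidLaw ρ = ∫ w, freshValue ρ n w ∂ρ :=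
  integral_iidLaw (measurable_winner n) (abs_winner_le n)

lemma measurable_ite_gain (n : ℕ) {p : ℝ → ℝ → Prop} [∀ u v, Decidable (p u v)]
    (hp : MeasurableSet {z : ℝ × ℝ | p z.1 z.2}) : Measurable fun x : ℕ → ℝ =>
      if p (x 0) (x 1) then gain n (x 0) (x 1) (tail (tail x)) else 0 := by
  refine Measurable.ite ?_ (Measurable.gain n (by fun_prop) (by fun_prop) (by fun_prop))
    measurable_const
  exact hp.preimage (f := fun x : ℕ → ℝ => (x 0, x 1)) (by fun_prop)

lemma abs_ite_le {p : Prop} [Decidable p] {r C : ℝ} (h : |r| ≤ C) :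
    |if p then r else 0| ≤ C := by
  split_ifs
  exacts [h, by simpa using (abs_nonneg r).trans h]

/-- Conditioning on the first two entries: the remaining ones are a fresh i.i.d. sequence. -/
lemma integral_ite_gain (n : ℕ) {p : ℝ → ℝ → Prop} [∀ u v, Decidable (p u v)]
    (hp : MeasurableSet {z : ℝ × ℝ | p z.1 z.2}) :
    ∫ x, (if p (x 0) (x 1) then gain n (x 0) (x 1) (tail (tail x)) else 0) ∂iidLaw ρ =
      ∫ u, ∫ v, (if p u v then gainValue ρ n u v else 0) ∂ρ ∂ρ := by
  have hm := measurable_ite_gain n hp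
  rw [integral_iidLaw hm fun x => abs_ite_le (abs_gain_le n _ _ _)]
  refine integral_congr_ae (ae_of_all _ fun u => ?_)
  have hm' := hm.comp (Measurable.prepend (measurable_const (a := u)) measurable_id)
  refine (integral_iidLaw (ρ := ρ) hm' fun x => abs_ite_le (abs_gain_le n _ _ _)).trans ?_
  refine integral_congr_ae (ae_of_all _ fun v => ?_)
  by_cases h : p u v <;> simp [h, gainValue]

lemma freshValue_succ (n : ℕ) (w : ℝ) :
    freshValue ρ (n + 1) w = ∫ u, freshValue ρ n u ∂ρ +
      ∫ u, ∫ v, (if u < w ∧ w < v then gainValue ρ (n - 1) u v else 0) ∂ρ ∂ρ := by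
  have hp : MeasurableSet {z : ℝ × ℝ | z.1 < w ∧ w < z.2} :=
    (measurableSet_lt measurable_fst measurable_const).inter
      (measurableSet_lt measurable_const measurable_snd)
  have hG := integral_ite_gain ρ (n - 1) (p := fun u v => u < w ∧ w < v) hp
  rw [← integral_winner, ← hG, freshValue, ← integral_add]
  · simp_rw [winner_succ_prepend]
  · exact .of_bound (measurable_winner n).aestronglyMeasurable 1 (ae_of_all _ (abs_winner_le n))
  · exact .of_bound (measurable_ite_gain (n - 1) (p := fun u v => u < w ∧ w < v) hp).aestronglyMeasurable 4
      (ae_of_all _ fun x => abs_ite_le (abs_gain_le _ _ _ _))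

lemma measurable_bias_integrand (a c : ℝ) :
    Measurable fun u : ℝ => ((if c < u then 1 else 0) - if u < a then 1 else 0 : ℝ) :=
  (Measurable.ite measurableSet_Ioi measurable_const measurable_const).sub
    (Measurable.ite measurableSet_Iio measurable_const measurable_const)

lemma abs_bias_integrand_le (a c u : ℝ) :
    |((if c < u then 1 else 0) - if u < a then 1 else 0 : ℝ)| ≤ 1 := by
  split_ifs <;> simp

lemma integral_bias_integrand (a c : ℝ) :
    ∫ x : ℕ → ℝ, ((if c < x 0 then 1 else 0) - if x 0 < a then 1 else 0) ∂iidLaw ρ =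
      bias ρ a c := by
  have h : (iidLaw ρ).map (fun x => x 0) = ρ := Measure.infinitePi_map_eval (fun _ => ρ) 0
  conv_rhs => rw [bias, ← h]
  rw [integral_map (measurable_pi_apply 0).aemeasurable
    (measurable_bias_integrand a c).aestronglyMeasurable]

lemma gainValue_zero (a c : ℝ) : gainValue ρ 0 a c = bias ρ a c := by
  unfold gainValue
  simp_rw [gain_zero]
  exact integral_bias_integrand ρ a c

lemma gainValue_succ (n : ℕ) {a c : ℝ} (hac : a < c) :
    gainValue ρ (n + 1) a c = bias ρ a c -
      ∫ u, (if c < u ∨ u < a then freshValue ρ n u else 0) ∂ρ -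
      ∫ u, ∫ v, (if u < a ∧ c < v then gainValue ρ (n - 1) u v else 0) ∂ρ ∂ρ := by
  have hp : MeasurableSet {z : ℝ × ℝ | z.1 < a ∧ c < z.2} :=
    (measurableSet_lt measurable_fst measurable_const).inter
      (measurableSet_lt measurable_const measurable_snd)
  have hm : Measurable fun x : ℕ → ℝ => if c < x 0 ∨ x 0 < a then winner n x else 0 := by
    refine Measurable.ite ?_ (measurable_winner n) measurable_const
    exact (measurableSet_Ioi.union measurableSet_Iio).preimage (measurable_pi_apply 0)
  have hb : ∀ x : ℕ → ℝ, |if c < x 0 ∨ x 0 < a then winner n x else 0| ≤ 1 :=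
    fun x => abs_ite_le (abs_winner_le n x)
  have hi : Integrable (fun x : ℕ → ℝ =>
      ((if c < x 0 then 1 else 0) - if x 0 < a then 1 else 0 : ℝ)) (iidLaw ρ) :=
    .of_bound ((measurable_bias_integrand a c).comp (measurable_pi_apply 0)).aestronglyMeasurable 1
      (ae_of_all _ fun x => abs_bias_integrand_le a c (x 0))
  have hi' : Integrable (fun x : ℕ → ℝ => if c < x 0 ∨ x 0 < a then winner n x else 0)
      (iidLaw ρ) := .of_bound hm.aestronglyMeasurable 1 (ae_of_all _ hb)
  have hG := integral_ite_gain ρ (n - 1) (p := fun u v => u < a ∧ c < v) hp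
  rw [gainValue, ← hG, ← integral_bias_integrand]
  simp_rw [gain_succ n hac]
  rw [integral_sub (f := fun x : ℕ → ℝ => _ - _) (hi.sub hi'), integral_sub hi hi',
    integral_iidLaw hm hb]
  · congr 2
    refine integral_congr_ae (ae_of_all _ fun u => ?_)
    by_cases h : c < u ∨ u < a <;> simp [h, freshValue]
  · exact .of_bound (measurable_ite_gain (n - 1) (p := fun u v => u < a ∧ c < v) hp).aestronglyMeasurable 4
      (ae_of_all _ fun x => abs_ite_le (abs_gain_le _ _ _ _))

/-! ### Antisymmetry under reflection -/

variable {ρ}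

/-- Reflection reverses order, so the roles of minimum and maximum must also be swapped, which is
Fubini. -/
lemma integral_integral_reflect (hρ : MeasurePreserving (fun u : ℝ => 1 - u) ρ ρ)
    {f : ℝ → ℝ → ℝ} (hf : Measurable fun p : ℝ × ℝ => f p.1 p.2) {C : ℝ}
    (hC : ∀ u v, |f u v| ≤ C) :
    ∫ u, ∫ v, f (1 - v) (1 - u) ∂ρ ∂ρ = ∫ u, ∫ v, f u v ∂ρ ∂ρ := by
  rw [integral_reflect hρ fun u => ∫ v, f (1 - v) u ∂ρ]
  simp_rw [fun u => integral_reflect hρ fun v => f v u]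
  refine integral_integral_swap (f := fun u v => f v u) ?_
  exact .of_bound (hf.comp measurable_swap).aestronglyMeasurable C (ae_of_all _ fun p => hC _ _)

lemma integral_integral_gainValue_reflect (hρ : MeasurePreserving (fun u : ℝ => 1 - u) ρ ρ)
    {n : ℕ} (h : ∀ a c, a < c → gainValue ρ n (1 - c) (1 - a) = -gainValue ρ n a c)
    {a c : ℝ} (hac : a ≤ c) :
    ∫ u, ∫ v, (if u < 1 - c ∧ 1 - a < v then gainValue ρ n u v else 0) ∂ρ ∂ρ =
      -∫ u, ∫ v, (if u < a ∧ c < v then gainValue ρ n u v else 0) ∂ρ ∂ρ := by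
  rw [← integral_integral_reflect hρ (C := 4) ?_ fun u v => abs_ite_le (abs_gainValue_le ρ n u v)]
  · simp_rw [← integral_neg]
    refine integral_congr_ae (ae_of_all _ fun u => integral_congr_ae (ae_of_all _ fun v => ?_))
    simp only [sub_lt_sub_iff_left]
    by_cases huv : u < a ∧ c < v
    · rw [if_pos huv, if_pos huv.symm, h u v (by linarith [huv.1, huv.2])]
    · rw [if_neg huv, if_neg fun h' => huv h'.symm, neg_zero]
  · refine Measurable.ite ?_ (measurable_gainValue ρ n) measurable_const
    exact (measurableSet_lt measurable_fst measurable_const).inter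
      (measurableSet_lt measurable_const measurable_snd)

/-- The two claims feed each other: level `n + 1` uses oddness of `freshValue` at level `n` and of
`gainValue` at level `n - 1`, hence strong induction. The constant term in `freshValue_succ`
vanishes as the integral of an odd function; the regions of integration are carried to their
reflected versions. -/
lemma value_antisymm (hρ : MeasurePreserving (fun u : ℝ => 1 - u) ρ ρ) (n : ℕ) :
    (∀ w, freshValue ρ n (1 - w) = -freshValue ρ n w) ∧
      ∀ a c, a < c → gainValue ρ n (1 - c) (1 - a) = -gainValue ρ n a c := by
  induction n using Nat.strong_induction_on with
  | _ n ih =>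
    cases n with
    | zero =>
      refine ⟨fun w => by simp [freshValue, winner], fun a c _ => ?_⟩
      rw [gainValue_zero, gainValue_zero, bias_reflect hρ]
    | succ n =>
      have hU := (ih n (by omega)).1
      have hR := (ih (n - 1) (by omega)).2
      refine ⟨fun w => ?_, fun a c hac => ?_⟩
      · rw [freshValue_succ, freshValue_succ, integral_eq_zero_of_antisymm hρ hU,
          integral_integral_gainValue_reflect hρ hR le_rfl]
        ring
      · rw [gainValue_succ ρ n hac, gainValue_succ ρ n (by linarith : 1 - c < 1 - a),
          bias_reflect hρ, integral_integral_gainValue_reflect hρ hR hac.le,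
          ← integral_reflect hρ fun u => if 1 - a < u ∨ u < 1 - c then freshValue ρ n u else 0]
        have : ∫ u, (if 1 - a < 1 - u ∨ 1 - u < 1 - c then freshValue ρ n (1 - u) else 0) ∂ρ =
            -∫ u, (if c < u ∨ u < a then freshValue ρ n u else 0) ∂ρ := by
          rw [← integral_neg]
          refine integral_congr_ae (ae_of_all _ fun u => ?_)
          simp only [sub_lt_sub_iff_left, hU, or_comm (a := u < a)]
          split_ifs <;> simp
        rw [this]
        ring

theorem integral_winner_eq_zero (hρ : MeasurePreserving (fun u : ℝ => 1 - u) ρ ρ) (n : ℕ) :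
    ∫ x, winner n x ∂iidLaw ρ = 0 := by
  rw [integral_winner, integral_eq_zero_of_antisymm hρ (value_antisymm hρ n).1]

end Expectation

/-! ### First occurrences -/

lemma occursAt_pat2134 (x : ℕ → ℝ) (i : ℕ) : OccursAt pat2134 x i ↔
    x (i + 1) < x i ∧ x i < x (i + 2) ∧ x (i + 2) < x (i + 3) := by
  simp only [OccursAt, Fin.forall_fin_succ, pat2134]
  simp
  grind

lemma occursAt_pat3241 (x : ℕ → ℝ) (i : ℕ) : OccursAt pat3241 x i ↔
    x (i + 3) < x (i + 1) ∧ x (i + 1) < x i ∧ x i < x (i + 2) := by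
  simp only [OccursAt, Fin.forall_fin_succ, pat3241]
  simp
  grind

lemma OccursAt.tail {k : ℕ} (σ : Equiv.Perm (Fin k)) (x : ℕ → ℝ) (i : ℕ) :
    OccursAt σ (tail x) i ↔ OccursAt σ x (i + 1) := by
  simp only [OccursAt, tail_apply, Nat.add_right_comm]

lemma firstTime_le {k : ℕ} {σ : Equiv.Perm (Fin k)} {x : ℕ → ℝ} {i : ℕ} (h : OccursAt σ x i) :
    firstTime σ x ≤ (i + k : ℕ) :=
  iInf₂_le (i + k) ⟨i, le_rfl, h⟩

lemma le_firstTime {k : ℕ} {σ : Equiv.Perm (Fin k)} {x : ℕ → ℝ} {m : ℕ}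
    (h : ∀ i < m, ¬ OccursAt σ x i) : ((m + k : ℕ) : ℕ∞) ≤ firstTime σ x := by
  refine le_iInf₂ fun n hn => ?_
  obtain ⟨i, hi, ho⟩ := hn
  have : ¬ i < m := fun h' => h i h' ho
  exact_mod_cast (by omega : m + k ≤ n)

lemma firstTime_eq_top {k : ℕ} {σ : Equiv.Perm (Fin k)} {x : ℕ → ℝ}
    (h : ∀ i, ¬ OccursAt σ x i) : firstTime σ x = ⊤ :=
  iInf₂_eq_top.2 fun _ ⟨i, _, hi⟩ => absurd hi (h i)

/-- If `σ` and `τ` have the same length and do not occur in the same window, then `σ` appears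
before `τ` exactly if it occurs in some window before which `τ` does not occur. -/
lemma firstTime_lt_iff {k : ℕ} {σ τ : Equiv.Perm (Fin k)} {x : ℕ → ℝ}
    (hστ : ∀ i, OccursAt σ x i → ¬ OccursAt τ x i) :
    firstTime σ x < firstTime τ x ↔ ∃ i, OccursAt σ x i ∧ ∀ j < i, ¬ OccursAt τ x j := by
  constructor
  · intro h
    have hne : ∃ i, OccursAt σ x i := by
      by_contra hc
      rw [firstTime_eq_top (not_exists.1 hc)] at h
      exact not_top_lt h
    classical
    refine ⟨Nat.find hne, Nat.find_spec hne, fun j hj hτ => ?_⟩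
    have h1 := le_firstTime (σ := σ) (m := Nat.find hne) fun i hi => Nat.find_min hne hi
    have h2 := (h1.trans_lt h).trans_le (firstTime_le hτ)
    have : Nat.find hne + k < j + k := by exact_mod_cast h2
    omega
  · rintro ⟨i, hσ, hτ⟩
    -- Window `i` itself is excluded for `τ` by `hστ`, which makes the inequality strict.
    refine (firstTime_le hσ).trans_lt (lt_of_lt_of_le ?_ (le_firstTime (m := i + 1) ?_))
    · exact_mod_cast (by omega : i + k < i + 1 + k)
    · intro j hj
      rcases Nat.lt_succ_iff_lt_or_eq.1 hj with hj | rfl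
      exacts [hτ j hj, hστ j hσ]

lemma not_occursAt_both {x : ℕ → ℝ} {i : ℕ} (h : OccursAt pat2134 x i) :
    ¬ OccursAt pat3241 x i := by
  rw [occursAt_pat2134] at h
  rw [occursAt_pat3241]
  intro h'
  linarith [h.1, h.2.1, h.2.2, h'.1]

lemma winner_succ (n : ℕ) (x : ℕ → ℝ) [Decidable (OccursAt pat2134 x 0)]
    [Decidable (OccursAt pat3241 x 0)] : winner (n + 1) x =
    if OccursAt pat2134 x 0 then 1 else if OccursAt pat3241 x 0 then -1 else winner n (tail x) := by
  simp only [winner, occursAt_pat2134, occursAt_pat3241, Nat.zero_add]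

lemma exists_occursAt_succ {k : ℕ} {σ τ : Equiv.Perm (Fin k)} {x : ℕ → ℝ} {n : ℕ}
    (h1 : ¬ OccursAt σ x 0) (h2 : ¬ OccursAt τ x 0) :
    (∃ i < n + 1, OccursAt σ x i ∧ ∀ j < i, ¬ OccursAt τ x j) ↔
      ∃ i < n, OccursAt σ (tail x) i ∧ ∀ j < i, ¬ OccursAt τ (tail x) j := by
  simp only [OccursAt.tail]
  constructor
  · rintro ⟨_ | i, hi, hσ, hτ⟩
    · exact absurd hσ h1
    · exact ⟨i, by omega, hσ, fun j hj => hτ (j + 1) (by omega)⟩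
  · rintro ⟨i, hi, hσ, hτ⟩
    refine ⟨i + 1, by omega, hσ, ?_⟩
    rintro (_ | j) hj
    exacts [h2, hτ j (by omega)]

lemma winner_eq_one_iff (n : ℕ) (x : ℕ → ℝ) : winner n x = 1 ↔
    ∃ i < n, OccursAt pat2134 x i ∧ ∀ j < i, ¬ OccursAt pat3241 x j := by
  classical
  induction n generalizing x with
  | zero => simp [winner]
  | succ n ih =>
    rw [winner_succ]
    split_ifs with h1 h2
    · exact iff_of_true rfl ⟨0, n.succ_pos, h1, by simp⟩
    · refine iff_of_false (by norm_num) ?_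
      rintro ⟨_ | i, _, hi, hj⟩
      exacts [h1 hi, hj 0 i.succ_pos h2]
    · rw [ih, exists_occursAt_succ h1 h2]

lemma winner_eq_neg_one_iff (n : ℕ) (x : ℕ → ℝ) : winner n x = -1 ↔
    ∃ i < n, OccursAt pat3241 x i ∧ ∀ j < i, ¬ OccursAt pat2134 x j := by
  classical
  induction n generalizing x with
  | zero => simp [winner]
  | succ n ih =>
    rw [winner_succ]
    split_ifs with h1 h2
    · refine iff_of_false (by norm_num) ?_
      rintro ⟨_ | i, _, hi, hj⟩
      exacts [not_occursAt_both h1 hi, hj 0 i.succ_pos h1]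
    · exact iff_of_true rfl ⟨0, n.succ_pos, h2, by simp⟩
    · rw [ih, exists_occursAt_succ h2 h1]

lemma winner_eq (n : ℕ) (x : ℕ → ℝ) :
    winner n x = {x | winner n x = 1}.indicator 1 x - {x | winner n x = -1}.indicator 1 x := by
  have : winner n x = 1 ∨ winner n x = -1 ∨ winner n x = 0 := by
    induction n generalizing x with
    | zero => simp [winner]
    | succ n ih => unfold winner; split_ifs; exacts [by simp, by simp, ih _]
  rcases this with h | h | h <;> simp [Set.indicator, h] <;> norm_num

lemma firstTime_lt_eq_iUnion : {x | firstTime pat2134 x < firstTime pat3241 x} =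
    ⋃ n, {x | winner n x = 1} := by
  ext x
  simp only [Set.mem_ofPred_eq, Set.mem_iUnion, winner_eq_one_iff,
    firstTime_lt_iff fun i h => not_occursAt_both (x := x) (i := i) h]
  exact ⟨fun ⟨i, hi⟩ => ⟨i + 1, i, i.lt_succ_self, hi⟩, fun ⟨_, i, _, hi⟩ => ⟨i, hi⟩⟩

lemma firstTime_gt_eq_iUnion : {x | firstTime pat3241 x < firstTime pat2134 x} =
    ⋃ n, {x | winner n x = -1} := by
  ext x
  simp only [Set.mem_ofPred_eq, Set.mem_iUnion, winner_eq_neg_one_iff,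
    firstTime_lt_iff fun i h h' => not_occursAt_both (x := x) (i := i) h' h]
  exact ⟨fun ⟨i, hi⟩ => ⟨i + 1, i, i.lt_succ_self, hi⟩, fun ⟨_, i, _, hi⟩ => ⟨i, hi⟩⟩

lemma measurableSet_firstTime_lt :
    MeasurableSet {x | firstTime pat2134 x < firstTime pat3241 x} := by
  rw [firstTime_lt_eq_iUnion]
  exact .iUnion fun n => measurable_winner n (measurableSet_singleton 1)

lemma measurableSet_firstTime_gt :
    MeasurableSet {x | firstTime pat3241 x < firstTime pat2134 x} := by
  rw [firstTime_gt_eq_iUnion]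
  exact .iUnion fun n => measurable_winner n (measurableSet_singleton (-1))

theorem iidLaw_firstTime_lt_eq_gt {ρ : Measure ℝ} [IsProbabilityMeasure ρ]
    (hρ : MeasurePreserving (fun u : ℝ => 1 - u) ρ ρ) :
    iidLaw ρ {x | firstTime pat2134 x < firstTime pat3241 x} =
      iidLaw ρ {x | firstTime pat3241 x < firstTime pat2134 x} := by
  rw [firstTime_lt_eq_iUnion, firstTime_gt_eq_iUnion, Monotone.measure_iUnion,
    Monotone.measure_iUnion]
  · congr 1 with n
    have h1 : MeasurableSet {x | winner n x = 1} :=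
      measurable_winner n (measurableSet_singleton 1)
    have h2 : MeasurableSet {x | winner n x = -1} :=
      measurable_winner n (measurableSet_singleton (-1))
    have h := integral_winner_eq_zero hρ n
    -- A single pass, because the right side of `winner_eq` contains `winner` again.
    simp_rw +singlePass [winner_eq n] at h
    rw [integral_sub ((integrable_const 1).indicator h1) ((integrable_const 1).indicator h2),
      integral_indicator_one h1, integral_indicator_one h2, sub_eq_zero] at h
    exact (measureReal_eq_measureReal_iff).1 h
  · intro m n hmn x hx
    simp only [Set.mem_ofPred_eq, winner_eq_neg_one_iff] at hx ⊢
    exact hx.imp fun i hi => ⟨hi.1.trans_le hmn, hi.2⟩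
  · intro m n hmn x hx
    simp only [Set.mem_ofPred_eq, winner_eq_one_iff] at hx ⊢
    exact hx.imp fun i hi => ⟨hi.1.trans_le hmn, hi.2⟩

/-! ### The pattern `2134` appears almost surely -/

lemma measurableSet_occursAt_pat2134 (i : ℕ) : MeasurableSet {x | OccursAt pat2134 x i} := by
  simp only [occursAt_pat2134]
  have h : ∀ m n : ℕ, MeasurableSet {x : ℕ → ℝ | x m < x n} := fun m n =>
    measurableSet_lt (measurable_pi_apply m) (measurable_pi_apply n)
  exact (h _ _).inter ((h _ _).inter (h _ _))

/-- Let `N` be the event that `2134` never occurs. The event `S1` prescribes intervals that force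
`2134` in the first window and puts the sequence after four entries in `N`. Then `N` and `S1` are
disjoint inside the fourfold shift preimage of `N`, which has the measure of `N`. So `S1` is null,
but its measure is a positive multiple of that of `N`. -/
theorem ae_exists_occursAt {ρ : Measure ℝ} [IsProbabilityMeasure ρ]
    {a b c d e : ℝ} (h1 : ρ (Set.Ioo a b) ≠ 0) (h2 : ρ (Set.Ioo b c) ≠ 0)
    (h3 : ρ (Set.Ioo c d) ≠ 0) (h4 : ρ (Set.Ioo d e) ≠ 0) :
    ∀ᵐ x ∂iidLaw ρ, ∃ i, OccursAt pat2134 x i := by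
  set N : Set (ℕ → ℝ) := {x | ∀ i, ¬ OccursAt pat2134 x i} with hN
  have hNm : MeasurableSet N := by
    rw [hN, Set.ofPred_forall]
    exact .iInter fun i => (measurableSet_occursAt_pat2134 i).compl
  have hT : MeasurableSet (tail ⁻¹' N) := hNm.preimage measurable_tail
  have hT2 : MeasurableSet (tail ⁻¹' (tail ⁻¹' N)) := hT.preimage measurable_tail
  have hT3 : MeasurableSet (tail ⁻¹' (tail ⁻¹' (tail ⁻¹' N))) := hT2.preimage measurable_tail
  set S4 := {x : ℕ → ℝ | x 0 ∈ Set.Ioo d e} ∩ tail ⁻¹' N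
  set S3 := {x : ℕ → ℝ | x 0 ∈ Set.Ioo c d} ∩ tail ⁻¹' S4
  set S2 := {x : ℕ → ℝ | x 0 ∈ Set.Ioo a b} ∩ tail ⁻¹' S3
  set S1 := {x : ℕ → ℝ | x 0 ∈ Set.Ioo b c} ∩ tail ⁻¹' S2
  have hI : ∀ s t : ℝ, MeasurableSet {x : ℕ → ℝ | x 0 ∈ Set.Ioo s t} := fun s t =>
    measurableSet_Ioo.preimage (measurable_pi_apply 0)
  have m4 : MeasurableSet S4 := (hI _ _).inter (hNm.preimage measurable_tail)
  have m3 : MeasurableSet S3 := (hI _ _).inter (m4.preimage measurable_tail)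
  have m2 : MeasurableSet S2 := (hI _ _).inter (m3.preimage measurable_tail)
  have m1 : MeasurableSet S1 := (hI _ _).inter (m2.preimage measurable_tail)
  have hS : iidLaw ρ S1 = ρ (Set.Ioo b c) * (ρ (Set.Ioo a b) * (ρ (Set.Ioo c d) *
      (ρ (Set.Ioo d e) * iidLaw ρ N))) := by
    rw [iidLaw_inter_tail ρ measurableSet_Ioo m2, iidLaw_inter_tail ρ measurableSet_Ioo m3,
      iidLaw_inter_tail ρ measurableSet_Ioo m4, iidLaw_inter_tail ρ measurableSet_Ioo hNm]
  have hdisj : Disjoint N S1 := by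
    refine Set.disjoint_left.2 fun x hx h => hx 0 ?_
    obtain ⟨h0, h1, h2, h3, -⟩ := h
    simp only [Set.mem_ofPred_eq, Set.mem_Ioo, tail_apply, zero_add, Nat.reduceAdd] at h0 h1 h2 h3
    rw [occursAt_pat2134]
    exact ⟨h1.2.trans h0.1, h0.2.trans h2.1, h2.2.trans h3.1⟩
  have hsub : N ∪ S1 ⊆ tail ⁻¹' (tail ⁻¹' (tail ⁻¹' (tail ⁻¹' N))) := by
    rintro x (hx | hx)
    · intro i
      simp only [OccursAt.tail]
      exact hx _
    · exact hx.2.2.2.2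
  have hle := measure_mono (μ := iidLaw ρ) hsub
  rw [measure_union hdisj m1, iidLaw_tail ρ hT3, iidLaw_tail ρ hT2, iidLaw_tail ρ hT,
    iidLaw_tail ρ hNm] at hle
  have h0 : iidLaw ρ S1 = 0 := by
    have := ENNReal.le_sub_of_add_le_left (measure_ne_top _ _) hle
    simpa using this
  rw [hS] at h0
  have : iidLaw ρ N = 0 := by simpa [h1, h2, h3, h4] using h0
  rw [ae_iff]
  simpa [hN] using this

theorem iidLaw_firstTime_lt_eq_half {ρ : Measure ℝ} [IsProbabilityMeasure ρ]
    (hρ : MeasurePreserving (fun u : ℝ => 1 - u) ρ ρ) {a b c d e : ℝ}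
    (h1 : ρ (Set.Ioo a b) ≠ 0) (h2 : ρ (Set.Ioo b c) ≠ 0)
    (h3 : ρ (Set.Ioo c d) ≠ 0) (h4 : ρ (Set.Ioo d e) ≠ 0) :
    iidLaw ρ {x | firstTime pat2134 x < firstTime pat3241 x} = 1 / 2 ∧
      iidLaw ρ {x | firstTime pat3241 x < firstTime pat2134 x} = 1 / 2 := by
  have heq := iidLaw_firstTime_lt_eq_gt hρ
  have hae : ∀ᵐ x ∂iidLaw ρ, x ∈ {x | firstTime pat2134 x < firstTime pat3241 x} ∪
      {x | firstTime pat3241 x < firstTime pat2134 x} := by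
    filter_upwards [ae_exists_occursAt h1 h2 h3 h4] with x hx
    have hx' : ∃ i, OccursAt pat2134 x i ∨ OccursAt pat3241 x i := hx.imp fun _ => .inl
    classical
    have hmin := fun j => Nat.find_min hx' (m := j)
    rcases Nat.find_spec hx' with h | h
    · exact .inl ((firstTime_lt_iff fun i h => not_occursAt_both h).2
        ⟨_, h, fun j hj h' => hmin j hj (.inr h')⟩)
    · exact .inr ((firstTime_lt_iff fun i h h' => not_occursAt_both h' h).2
        ⟨_, h, fun j hj h' => hmin j hj (.inl h')⟩)
  have hsum : iidLaw ρ {x | firstTime pat2134 x < firstTime pat3241 x} +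
      iidLaw ρ {x | firstTime pat3241 x < firstTime pat2134 x} = 1 := by
    rw [← measure_union _ measurableSet_firstTime_gt]
    · exact prob_compl_eq_zero_iff
        (measurableSet_firstTime_lt.union measurableSet_firstTime_gt) |>.1 hae
    · exact Set.disjoint_left.2 fun x hx hx' => lt_asymm (a := firstTime pat2134 x) hx hx'
  have key : iidLaw ρ {x | firstTime pat3241 x < firstTime pat2134 x} = 1 / 2 := by
    rw [heq, ← two_mul] at hsum
    rw [ENNReal.eq_div_iff (by norm_num) (by norm_num), hsum]
  exact ⟨heq.trans key, key⟩

/-! ### Reduction to the uniform distribution -/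

/-- The uniform distribution on the unit interval. -/
noncomputable abbrev uniformLaw : Measure ℝ := volume.restrict (Set.Icc 0 1)

instance : IsProbabilityMeasure uniformLaw := ⟨by simp⟩

lemma measurePreserving_uniformLaw :
    MeasurePreserving (fun u : ℝ => 1 - u) uniformLaw uniformLaw := by
  have h := (Measure.measurePreserving_sub_left (volume : Measure ℝ) 1).restrict_preimage
    (measurableSet_Icc (a := (0 : ℝ)) (b := 1))
  simpa using h

lemma uniformLaw_Ioo_ne_zero {a b : ℝ} (h0 : 0 ≤ a) (hab : a < b) (h1 : b ≤ 1) :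
    uniformLaw (Set.Ioo a b) ≠ 0 := by
  rw [Measure.restrict_apply measurableSet_Ioo, Set.inter_eq_left.2
    (Set.Ioo_subset_Icc_self.trans (Set.Icc_subset_Icc h0 h1))]
  simpa using hab

lemma cdf_uniformLaw {t : ℝ} (h0 : 0 ≤ t) (h1 : t ≤ 1) : cdf uniformLaw t = t := by
  have : Set.Iic t ∩ Set.Icc 0 1 = Set.Icc 0 t := by
    ext x
    simp only [Set.mem_inter_iff, Set.mem_Iic, Set.mem_Icc]
    constructor
    · exact fun h => ⟨h.2.1, h.1⟩
    · exact fun h => ⟨h.2, h.1, h.2.trans h1⟩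
  rw [cdf_eq_real, measureReal_restrict_apply measurableSet_Iic, this]
  simp [h0]

/-- The jump of the distribution function at a point is the mass of that point. -/
lemma continuous_cdf (ν : Measure ℝ) [IsProbabilityMeasure ν] [NullSingletonClass ν] :
    Continuous (cdf ν) := by
  refine continuous_iff_continuousAt.2 fun x => ?_
  have h := (cdf ν).measure_singleton x
  rw [measure_cdf, measure_singleton, eq_comm, ENNReal.ofReal_eq_zero, sub_nonpos] at h
  refine continuousAt_iff_continuous_left'_right'.2 ⟨?_, ?_⟩
  · rw [(monotone_cdf ν).continuousWithinAt_Iio_iff_leftLim_eq]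
    exact le_antisymm ((monotone_cdf ν).leftLim_le le_rfl) h
  · exact ((cdf ν).right_continuous x).mono Set.Ioi_subset_Ici_self

lemma map_cdf (ν : Measure ℝ) [IsProbabilityMeasure ν] [NullSingletonClass ν] :
    ν.map (cdf ν) = uniformLaw := by
  have hm : Measurable (cdf ν) := (monotone_cdf ν).measurable
  have : IsProbabilityMeasure (ν.map (cdf ν)) := Measure.isProbabilityMeasure_map hm.aemeasurable
  refine Measure.eq_of_cdf _ _ ?_
  have hap : ∀ t, cdf (ν.map (cdf ν)) t = ν.real {x | cdf ν x ≤ t} := fun t => by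
    rw [cdf_eq_real, map_measureReal_apply hm measurableSet_Iic]; rfl
  have hex : ∀ t, 0 < t → t < 1 → ∃ x, cdf ν x = t := fun t h0 h1 => by
    obtain ⟨a, ha⟩ := ((tendsto_cdf_atBot ν).eventually (gt_mem_nhds h0)).exists
    obtain ⟨b, hb⟩ := ((tendsto_cdf_atTop ν).eventually (lt_mem_nhds h1)).exists
    exact mem_range_of_exists_le_of_exists_ge (continuous_cdf ν) ⟨a, ha.le⟩ ⟨b, hb.le⟩
  have hge : ∀ t, 0 < t → t < 1 → t ≤ cdf (ν.map (cdf ν)) t := fun t h0 h1 => by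
    obtain ⟨x, hx⟩ := hex t h0 h1
    rw [hap]
    conv_lhs => rw [← hx, cdf_eq_real]
    exact measureReal_mono fun y hy => (monotone_cdf ν hy).trans hx.le
  -- The distribution function may have flat stretches, so `cdf ν y ≤ t = cdf ν x` need not give `y
  -- ≤ x`; a strictly smaller level `s` does.
  have hle : ∀ s t, s < t → 0 < t → t < 1 → cdf (ν.map (cdf ν)) s ≤ t := fun s t hst h0 h1 => by
    obtain ⟨x, hx⟩ := hex t h0 h1
    rw [hap]
    conv_rhs => rw [← hx, cdf_eq_real]
    refine measureReal_mono fun y hy => ?_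
    by_contra hc
    have := monotone_cdf ν (not_le.1 hc).le
    simp only [Set.mem_ofPred_eq] at hy
    linarith
  have key : ∀ t, 0 < t → t < 1 → cdf (ν.map (cdf ν)) t = t := fun t h0 h1 => by
    refine le_antisymm (le_of_forall_gt_imp_ge_of_dense fun s hs => ?_) (hge t h0 h1)
    rcases lt_or_ge s 1 with h | h
    · exact hle t s hs (h0.trans hs) h
    · exact (cdf_le_one _ _).trans h
  ext t
  -- Outside `(0, 1)`, monotonicity and the values inside already determine a distribution function.
  rcases le_or_gt t 0 with h0 | h0
  · have e : ∀ κ : Measure ℝ, IsProbabilityMeasure κ →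
        (∀ t, 0 < t → t < 1 → cdf κ t = t) → cdf κ t = 0 := fun κ _ hκ => by
      refine le_antisymm (le_of_forall_gt_imp_ge_of_dense fun s hs => ?_) (cdf_nonneg _ _)
      have h2 : 0 < min s (1 / 2) := lt_min hs (by norm_num)
      refine (monotone_cdf κ (h0.trans h2.le)).trans ?_
      rw [hκ _ h2 ((min_le_right _ _).trans_lt (by norm_num))]
      exact min_le_left _ _
    rw [e _ ‹_› key, e _ inferInstance fun t h h' => cdf_uniformLaw h.le h'.le]
  · rcases lt_or_ge t 1 with h1 | h1
    · rw [key t h0 h1, cdf_uniformLaw h0.le h1.le]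
    · have e : ∀ κ : Measure ℝ, IsProbabilityMeasure κ →
          (∀ t, 0 < t → t < 1 → cdf κ t = t) → cdf κ t = 1 := fun κ _ hκ => by
        refine le_antisymm (cdf_le_one _ _) (le_of_forall_lt_imp_le_of_dense fun s hs => ?_)
        have h2 : max s (1 / 2) < 1 := max_lt hs (by norm_num)
        refine le_trans ?_ (monotone_cdf κ (h2.le.trans h1))
        rw [hκ _ (lt_of_lt_of_le (by norm_num) (le_max_right _ _)) h2]
        exact le_max_left _ _
      rw [e _ ‹_› key, e _ inferInstance fun t h h' => cdf_uniformLaw h.le h'.le]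

section Reduction

variable {Ω : Type*} [MeasurableSpace Ω] {μ : Measure Ω} [IsProbabilityMeasure μ]
  {X : ℕ → Ω → ℝ}

lemma ae_ne_of_indepFun {Y Z : Ω → ℝ} (hY : Measurable Y) (hZ : Measurable Z)
    (h : IndepFun Y Z μ) [NullSingletonClass (μ.map Z)] : ∀ᵐ ω ∂μ, Y ω ≠ Z ω := by
  have hd : MeasurableSet {p : ℝ × ℝ | p.1 = p.2} :=
    measurableSet_eq_fun measurable_fst measurable_snd
  have := Measure.isProbabilityMeasure_map (μ := μ) hY.aemeasurable
  have := Measure.isProbabilityMeasure_map (μ := μ) hZ.aemeasurable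
  have h0 : (μ.map fun ω => (Y ω, Z ω)) {p : ℝ × ℝ | p.1 = p.2} = 0 := by
    rw [(indepFun_iff_map_prod_eq_prod_map_map hY.aemeasurable hZ.aemeasurable).1 h,
      Measure.prod_apply hd]
    refine lintegral_eq_zero_of_ae_eq_zero (ae_of_all _ fun y => ?_)
    have : Prod.mk y ⁻¹' {p : ℝ × ℝ | p.1 = p.2} = {y} := by
      ext z; simp [eq_comm]
    beta_reduce
    rw [this, measure_singleton, Pi.zero_apply]
  rw [Measure.map_apply (hY.prodMk hZ) hd] at h0
  simpa [ae_iff] using h0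

/-- The distribution function is only weakly monotone, but the transformed variables are independent
and atomless, hence almost surely distinct, so strict order is preserved both ways. -/
theorem IsIIDContinuous.exists_uniform (hX : IsIIDContinuous μ X) :
    ∃ Y : ℕ → Ω → ℝ, (∀ n, Measurable (Y n)) ∧ iIndepFun Y μ ∧ (∀ n, μ.map (Y n) = uniformLaw) ∧
      ∀ᵐ ω ∂μ, ∀ i j, Y i ω < Y j ω ↔ X i ω < X j ω := by
  have := Measure.isProbabilityMeasure_map (μ := μ) (hX.measurable 0).aemeasurable
  have : NullSingletonClass (μ.map (X 0)) := ⟨fun c => by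
    rw [Measure.map_apply (hX.measurable 0) (measurableSet_singleton c)]
    exact hX.noAtoms 0 c⟩
  set F := cdf (μ.map (X 0))
  have hF : Measurable F := (monotone_cdf _).measurable
  have hm : ∀ n, Measurable fun ω => F (X n ω) := fun n => hF.comp (hX.measurable n)
  have hind : iIndepFun (fun n ω => F (X n ω)) μ := hX.indep.comp (fun _ => F) fun _ => hF
  have hlaw : ∀ n, μ.map (fun ω => F (X n ω)) = uniformLaw := fun n => by
    have h := Measure.map_map (μ := μ) hF (hX.measurable n)
    rw [(hX.identDistrib n).map_eq] at h
    exact h.symm.trans (map_cdf _)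
  refine ⟨fun n ω => F (X n ω), hm, hind, hlaw, ?_⟩
  have hne : ∀ᵐ ω ∂μ, ∀ i j, i ≠ j → F (X i ω) ≠ F (X j ω) := by
    refine ae_all_iff.2 fun i => ae_all_iff.2 fun j => ?_
    by_cases hij : i = j
    · exact ae_of_all _ fun ω h => absurd hij h
    · have : NullSingletonClass (μ.map fun ω => F (X j ω)) := by rw [hlaw j]; infer_instance
      filter_upwards [ae_ne_of_indepFun (hm i) (hm j) (hind.indepFun hij)] with ω hω _ using hω
  filter_upwards [hne] with ω hω i j
  refine ⟨fun h => (monotone_cdf _).reflect_lt h, fun h => ?_⟩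
  refine lt_of_le_of_ne (monotone_cdf _ h.le) (hω i j ?_)
  rintro rfl
  exact lt_irrefl _ h

lemma firstTime_congr {k : ℕ} (σ : Equiv.Perm (Fin k)) {x y : ℕ → ℝ}
    (h : ∀ i j, x i < x j ↔ y i < y j) : firstTime σ x = firstTime σ y := by
  simp only [firstTime, PrefixContains, OccursAt, h]

end Reduction

end PermPenney

theorem mainTheorem1 {Ω : Type*} [MeasurableSpace Ω] (μ : Measure Ω) [IsProbabilityMeasure μ]
    (X : ℕ → Ω → ℝ) (hX : PermPenney.IsIIDContinuous μ X) :
    PermPenney.IsTied μ X PermPenney.pat2134 PermPenney.pat3241 := by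
  open PermPenney in
  obtain ⟨Y, hYm, hYi, hYl, hXY⟩ := hX.exists_uniform
  have hlaw : μ.map (fun ω n => Y n ω) = iidLaw uniformLaw := by
    rw [hYi.map_fun_eq_infinitePi_map hYm]
    simp_rw [hYl]
  have hmeas : Measurable fun ω n => Y n ω := measurable_pi_iff.2 hYm
  obtain ⟨h1, h2⟩ := iidLaw_firstTime_lt_eq_half measurePreserving_uniformLaw
    (uniformLaw_Ioo_ne_zero (a := 0) (b := 1 / 4) (by norm_num) (by norm_num) (by norm_num))
    (uniformLaw_Ioo_ne_zero (b := 1 / 2) (by norm_num) (by norm_num) (by norm_num))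
    (uniformLaw_Ioo_ne_zero (b := 3 / 4) (by norm_num) (by norm_num) (by norm_num))
    (uniformLaw_Ioo_ne_zero (b := 1) (by norm_num) (by norm_num) (by norm_num))
  rw [← hlaw, Measure.map_apply hmeas measurableSet_firstTime_lt] at h1
  rw [← hlaw, Measure.map_apply hmeas measurableSet_firstTime_gt] at h2
  refine ⟨(measure_congr ?_).trans h1, (measure_congr ?_).trans h2⟩ <;>
  · filter_upwards [hXY] with ω hω
    refine propext ?_
    change firstTime _ _ < firstTime _ _ ↔ firstTime _ _ < firstTime _ _
    rw [firstTime_congr pat2134 hω, firstTime_congr pat3241 hω]
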